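/- Let $\ell\ge 1$ and let $\mathfrak a=\bigoplus_{\mathbf r\in\mathbb Z_{\ge0}^\ell}\mathfrak a[\mathbf r]$ be a $\mathbb Z_{\ge 0}^\ell$-graded complex Lie algebra such that every $\mathfrak a[\mathbf r]$ is finite-dimensional and $\mathfrak g:=\mathfrak a[\mathbf 0]$ is semisimple. Put $\mathfrak a_+=\bigoplus_{\mathbf r\ne\mathbf 0}\mathfrak a[\mathbf r]$. Fix a Cartan subalgebra $\mathfrak h$ of $\mathfrak g$ and a system of positive roots, let $P^+\subset\mathfrak h^*$ be the $\mathbb Z_{\ge0}$-span of the fundamental weights and, for $\lambda\in P^+$, let $V(\lambda)$ be the irreducible $\mathfrak g$-module of highest weight $\lambda$. Let $\mathcal G$ be the category of $\mathbb Z^\ell$-graded $\mathfrak a$-modules with finite-dimensional graded pieces, whose morphisms are the degree-preserving $\mathfrak a$-module maps. For $(\lambda,\mathbf r)\in P^+\times\mathbb Z^\ell$ let $V(\lambda,\mathbf r)$ be the graded $\mathfrak a$-module given by $V(\lambda)$ placed in degree $\mathbf r$, with $\mathfrak a_+$ acting by zero. (1) Every simple object of $\mathcal G$ is isomorphic to $V(\lambda,\mathbf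 r)$ for a unique $(\lambda,\mathbf r)\in P^+\times\mathbb Z^\ell$. (2) Regard $\mathfrak a$ as a $\mathbb Z_{\ge0}$-graded Lie algebra by total degree, with $n$-th piece $\bigoplus_{r_1+\dots+r_\ell=n}\mathfrak a[\mathbf r]$, and let $\mathcal D$ be the category of $\mathbb Z$-graded modules with finite-dimensional graded pieces over this graded Lie algebra, with degree-preserving module maps. Then every simple object of $\mathcal D$ is isomorphic, for a unique $(\lambda,r)\in P^+\times\mathbb Z$, to the module $V(\lambda,r)$ given by $V(\lambda)$ placed in degree $r\in\mathbb Z$, with $\mathfrak a_+$ acting by zero. -/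

import Mathlib

open CategoryTheory

universe u

noncomputable section

namespace MultigradedLie

/-! ## Irreducible highest weight modules -/

section HighestWeight

variable {L : Type u} [LieRing L] [LieAlgebra ℂ L] [FiniteDimensional ℂ L]
  [LieAlgebra.IsSemisimple ℂ L] {H : LieSubalgebra ℂ L} [H.IsCartanSubalgebra]
  (b : (LieAlgebra.IsKilling.rootSystem H).Base)

/-- The fundamental weight `ω_i` attached to a simple root `α_i`: the functional on the Cartan
subalgebra with `ω_i (h_j) = δ_{ij}`, where `h_j` are the simple coroots (which form a basis). -/
def fundamentalWeight (i : b.support) : Module.Dual ℂ H :=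
  b.toCoweightBasis.coord i

/-- The set `P⁺` of dominant integral weights: the `ℤ_{≥0}`-span of the fundamental weights. -/
def dominantWeights : AddSubmonoid (Module.Dual ℂ H) :=
  AddSubmonoid.closure (Set.range (fundamentalWeight b))

open scoped Classical in
theorem fundamentalWeight_apply (i j : b.support) :
    fundamentalWeight b i ((LieAlgebra.IsKilling.rootSystem H).coroot j) =
      if j = i then 1 else 0 := by
  have h : (LieAlgebra.IsKilling.rootSystem H).coroot j = b.toCoweightBasis j := by simp
  rw [h, fundamentalWeight, Module.Basis.coord_apply, Module.Basis.repr_self, Finsupp.single_apply]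

/-- The left ideal of `U(L)` generated by `𝔫⁺` and by `h - λ(h)` for `h` in the Cartan subalgebra.
The quotient of `U(L)` by it is the Verma module of highest weight `λ`. -/
def vermaIdeal (wt : Module.Dual ℂ H) :
    Submodule (UniversalEnvelopingAlgebra ℂ L) (UniversalEnvelopingAlgebra ℂ L) :=
  Submodule.span _
    ({u | ∃ α : H.root, b.IsPos α ∧ ∃ x ∈ LieAlgebra.rootSpace H (α : LieModule.Weight ℂ H L),
        u = UniversalEnvelopingAlgebra.ι ℂ x} ∪
     {u | ∃ h : H, u = UniversalEnvelopingAlgebra.ι ℂ (h : L) -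
        algebraMap ℂ (UniversalEnvelopingAlgebra ℂ L) (wt h)})

/-- The sum of all proper left ideals containing `vermaIdeal`. Modulo `vermaIdeal` it is the
largest proper submodule of the Verma module. -/
def maximalIdeal (wt : Module.Dual ℂ H) :
    Submodule (UniversalEnvelopingAlgebra ℂ L) (UniversalEnvelopingAlgebra ℂ L) :=
  sSup {J | vermaIdeal b wt ≤ J ∧ J ≠ ⊤}

/-- The irreducible module `V(λ)` of highest weight `λ`: the quotient of the Verma module by its
largest proper submodule. -/
def HWModule (wt : Module.Dual ℂ H) : Type u :=
  UniversalEnvelopingAlgebra ℂ L ⧸ maximalIdeal b wt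

instance (wt : Module.Dual ℂ H) : AddCommGroup (HWModule b wt) :=
  inferInstanceAs (AddCommGroup (UniversalEnvelopingAlgebra ℂ L ⧸ maximalIdeal b wt))

instance (wt : Module.Dual ℂ H) : Module ℂ (HWModule b wt) :=
  inferInstanceAs (Module ℂ (UniversalEnvelopingAlgebra ℂ L ⧸ maximalIdeal b wt))

instance (wt : Module.Dual ℂ H) : Module (UniversalEnvelopingAlgebra ℂ L) (HWModule b wt) :=
  inferInstanceAs (Module (UniversalEnvelopingAlgebra ℂ L)
    (UniversalEnvelopingAlgebra ℂ L ⧸ maximalIdeal b wt))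

instance (wt : Module.Dual ℂ H) :
    IsScalarTower ℂ (UniversalEnvelopingAlgebra ℂ L) (HWModule b wt) :=
  inferInstanceAs (IsScalarTower ℂ (UniversalEnvelopingAlgebra ℂ L)
    (UniversalEnvelopingAlgebra ℂ L ⧸ maximalIdeal b wt))

instance (wt : Module.Dual ℂ H) : LieRingModule L (HWModule b wt) where
  bracket x m := UniversalEnvelopingAlgebra.ι ℂ x • m
  add_lie x y m := by
    rw [map_add, add_smul]
  lie_add x m n := smul_add (UniversalEnvelopingAlgebra.ι ℂ x) m n
  leibniz_lie x y m := by
    change UniversalEnvelopingAlgebra.ι ℂ x • UniversalEnvelopingAlgebra.ι ℂ y • m =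
      UniversalEnvelopingAlgebra.ι ℂ ⁅x, y⁆ • m +
        UniversalEnvelopingAlgebra.ι ℂ y • UniversalEnvelopingAlgebra.ι ℂ x • m
    let : LieRing (UniversalEnvelopingAlgebra ℂ L) := LieRing.ofAssociativeRing
    rw [LieHom.map_lie, LieRing.of_associative_ring_bracket, sub_smul, mul_smul, mul_smul,
      sub_add_cancel]

instance (wt : Module.Dual ℂ H) : LieModule ℂ L (HWModule b wt) where
  smul_lie t x m := by
    change UniversalEnvelopingAlgebra.ι ℂ (t • x) • m =
      t • UniversalEnvelopingAlgebra.ι ℂ x • m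
    rw [map_smul, smul_assoc]
  lie_smul t x m := by
    change UniversalEnvelopingAlgebra.ι ℂ x • t • m = t • UniversalEnvelopingAlgebra.ι ℂ x • m
    rw [← algebraMap_smul (UniversalEnvelopingAlgebra ℂ L) t m,
      ← algebraMap_smul (UniversalEnvelopingAlgebra ℂ L) t (_ • m), smul_smul, smul_smul,
      Algebra.commutes]

end HighestWeight

/-! ## Graded modules over a graded Lie algebra

The Lie algebra `𝔞` is graded by a monoid `I` and the modules by a group `Γ`, through a homomorphism
`c : I → Γ`; below `c` is one of the inclusions `ℤ_{≥0}^ℓ ⊆ ℤ^ℓ` and `ℤ_{≥0} ⊆ ℤ`. -/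

section Graded

variable {I Γ : Type} [AddCommMonoid I] [AddCommGroup Γ] [DecidableEq Γ]
  {𝔞 : Type u} [LieRing 𝔞] [LieAlgebra ℂ 𝔞]

/-- A `Γ`-graded `𝔞`-module. -/
structure GradedRep (c : I →+ Γ) (𝒜 : I → Submodule ℂ 𝔞) where
  carrier : Type u
  [addCommGroup : AddCommGroup carrier]
  [module : Module ℂ carrier]
  [lieRingModule : LieRingModule 𝔞 carrier]
  [lieModule : LieModule ℂ 𝔞 carrier]
  /-- The graded piece of degree `s`. -/
  piece : Γ → Submodule ℂ carrier
  isInternal : DirectSum.IsInternal piece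
  lie_mem : ∀ (i : I) (s : Γ) (x : 𝔞) (v : carrier),
    x ∈ 𝒜 i → v ∈ piece s → ⁅x, v⁆ ∈ piece (c i + s)

attribute [instance] GradedRep.addCommGroup GradedRep.module GradedRep.lieRingModule
  GradedRep.lieModule

variable {c : I →+ Γ} {𝒜 : I → Submodule ℂ 𝔞}

/-- A morphism of graded modules: an `𝔞`-module map preserving the degrees. -/
@[ext]
structure GradedRep.Hom (V W : GradedRep c 𝒜) where
  toLieModuleHom : V.carrier →ₗ⁅ℂ, 𝔞⁆ W.carrier
  map_piece : ∀ (s : Γ) (v : V.carrier), v ∈ V.piece s → toLieModuleHom v ∈ W.piece s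

instance : Category (GradedRep c 𝒜) where
  Hom := GradedRep.Hom
  id _ := ⟨LieModuleHom.id, fun _ _ h => h⟩
  comp f g := ⟨g.toLieModuleHom.comp f.toLieModuleHom,
    fun s v h => g.map_piece s _ (f.map_piece s v h)⟩

instance : Limits.HasZeroMorphisms (GradedRep c 𝒜) where
  zero _ W := ⟨⟨0, fun s _ _ => (W.piece s).zero_mem⟩⟩
  comp_zero _ _ := rfl
  zero_comp _ _ _ f := GradedRep.Hom.ext (LieModuleHom.ext fun _ => f.toLieModuleHom.map_zero)

variable (c 𝒜) in
/-- The property of having finite-dimensional graded pieces. -/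
def hasFinitePieces : ObjectProperty (GradedRep c 𝒜) :=
  fun V => ∀ s : Γ, FiniteDimensional ℂ (V.piece s)

/-- Let `M` be a module over a Lie algebra `L` and let `π : 𝔞 → L` be a homomorphism killing the
pieces of nonzero degree of `𝔞`. Then `M`, with `𝔞` acting through `π`, is a graded `𝔞`-module
concentrated in degree `r`. -/
def concentratedAt {L : Type u} [LieRing L] [LieAlgebra ℂ L] (π : 𝔞 →ₗ⁅ℂ⁆ L)
    (hπ : ∀ (i : I) (x : 𝔞), x ∈ 𝒜 i → c i ≠ 0 → π x = 0)
    (M : Type u) [AddCommGroup M] [Module ℂ M] [LieRingModule L M] [LieModule ℂ L M] (r : Γ) :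
    GradedRep c 𝒜 where
  carrier := M
  lieRingModule := LieRingModule.compLieHom M π
  lieModule := LieModule.compLieHom M π
  piece s := if s = r then ⊤ else ⊥
  isInternal := by
    rw [DirectSum.isInternal_submodule_iff_iSupIndep_and_iSup_eq_top]
    constructor
    · intro s
      by_cases hs : s = r
      · subst hs
        have : (⨆ j, ⨆ (_ : j ≠ s), (if j = s then (⊤ : Submodule ℂ M) else ⊥)) = ⊥ := by
          simp only [iSup_eq_bot]
          intro j hj
          simp [hj]
        rw [this]
        exact disjoint_bot_right
      · simp [hs]
    · rw [eq_top_iff]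
      refine le_trans ?_ (le_iSup _ r)
      simp
  lie_mem i s x v hx hv := by
    change ⁅π x, v⁆ ∈ _
    by_cases hi : c i = 0
    · rw [hi, zero_add]
      by_cases hs : s = r
      · simp [hs]
      · rw [if_neg hs] at hv
        rw [(Submodule.mem_bot ℂ).1 hv, lie_zero]
        exact Submodule.zero_mem _
    · rw [hπ i x hx hi, zero_lie]
      exact Submodule.zero_mem _

end Graded

/-! ## The categories `𝒢` and `𝒟` and the modules `V(λ, r)` -/

section Multigraded

variable {l : ℕ} {𝔞 : Type u} [LieRing 𝔞] [LieAlgebra ℂ 𝔞]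
  (𝒜 : (Fin l → ℕ) → Submodule ℂ 𝔞)

/-- The inclusion `ℤ_{≥0}^ℓ → ℤ^ℓ`. -/
def inclusion (l : ℕ) : (Fin l → ℕ) →+ (Fin l → ℤ) where
  toFun r j := r j
  map_zero' := by ext; simp
  map_add' r s := by ext; simp

/-- The category `𝒢` of `ℤ^ℓ`-graded `𝔞`-modules with finite-dimensional graded pieces. -/
abbrev CatG := (hasFinitePieces (inclusion l) 𝒜).FullSubcategory

/-- The `ℤ_{≥0}`-grading of `𝔞` by total degree, `𝔞[n] = ⨁_{deg r = n} 𝔞[r]`. The Lie algebra `𝔞`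
with this grading is `𝒟(𝔞)`. -/
def totalGrading (n : ℕ) : Submodule ℂ 𝔞 :=
  ⨆ (r : Fin l → ℕ) (_ : ∑ j, r j = n), 𝒜 r

/-- The category `𝒟` of `ℤ`-graded `𝒟(𝔞)`-modules with finite-dimensional graded pieces. -/
abbrev CatD := (hasFinitePieces (Nat.castAddMonoidHom ℤ) (totalGrading 𝒜)).FullSubcategory

variable [GradedLieAlgebra 𝒜]

/-- The subalgebra `𝔤 = 𝔞[0]`. -/
def degreeZero : LieSubalgebra ℂ 𝔞 where
  __ := 𝒜 0
  lie_mem' {x y} hx hy := by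
    simpa using SetLike.GradedBracket.bracket_mem (ℒ := 𝒜) (i := 0) (j := 0) hx hy

instance [FiniteDimensional ℂ (𝒜 0)] : FiniteDimensional ℂ (degreeZero 𝒜) :=
  inferInstanceAs (FiniteDimensional ℂ (𝒜 0))

theorem decompose_lie_zero (x y : 𝔞) :
    (DirectSum.decompose 𝒜 ⁅x, y⁆ 0 : 𝔞) =
      ⁅(DirectSum.decompose 𝒜 x 0 : 𝔞), (DirectSum.decompose 𝒜 y 0 : 𝔞)⁆ := by
  induction x using DirectSum.Decomposition.inductionOn 𝒜 with
  | zero => simp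
  | add x x' hx hx' => 
    simp only [add_lie, DirectSum.decompose_add, DirectSum.add_apply, Submodule.coe_add, hx, hx']
  | @homogeneous i x =>
    induction y using DirectSum.Decomposition.inductionOn 𝒜 with
    | zero => simp
    | add y y' hy hy' => 
      simp only [lie_add, DirectSum.decompose_add, DirectSum.add_apply, Submodule.coe_add, hy, hy']
    | @homogeneous j y =>
      have hxy : ⁅(x : 𝔞), (y : 𝔞)⁆ ∈ 𝒜 (i + j) :=
        SetLike.GradedBracket.bracket_mem x.2 y.2
      by_cases hi : i = 0
      · subst hi
        by_cases hj : j = 0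
        · subst hj
          rw [DirectSum.decompose_of_mem_same 𝒜 (by simpa using hxy),
            DirectSum.decompose_of_mem_same 𝒜 x.2, DirectSum.decompose_of_mem_same 𝒜 y.2]
        · rw [DirectSum.decompose_of_mem_ne 𝒜 hxy (by simpa using hj),
            DirectSum.decompose_of_mem_ne 𝒜 y.2 hj, lie_zero]
      · rw [DirectSum.decompose_of_mem_ne 𝒜 hxy (fun h => hi (add_eq_zero.1 h).1),
          DirectSum.decompose_of_mem_ne 𝒜 x.2 hi, zero_lie]

/-- The projection `𝔞 → 𝔤` along `𝔞₊ = ⨁_{r ≠ 0} 𝔞[r]`. -/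
def toDegreeZero : 𝔞 →ₗ⁅ℂ⁆ degreeZero 𝒜 where
  toFun x := ⟨DirectSum.decompose 𝒜 x 0, (DirectSum.decompose 𝒜 x 0).2⟩
  map_add' x y := Subtype.ext (by simp [DirectSum.decompose_add])
  map_smul' t x := Subtype.ext (by
    rw [DirectSum.decompose_smul, DirectSum.smul_apply]
    rfl)
  map_lie' {x y} := Subtype.ext (decompose_lie_zero 𝒜 x y)

theorem toDegreeZero_eq_zero {r : Fin l → ℕ} (hr : r ≠ 0) {x : 𝔞} (hx : x ∈ 𝒜 r) :
    toDegreeZero 𝒜 x = 0 :=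
  Subtype.ext (DirectSum.decompose_of_mem_ne 𝒜 hx hr)

theorem toDegreeZero_eq_zero_of_mem_totalGrading {n : ℕ} (hn : n ≠ 0) {x : 𝔞}
    (hx : x ∈ totalGrading 𝒜 n) : toDegreeZero 𝒜 x = 0 := by
  have h : totalGrading 𝒜 n ≤ LinearMap.ker (toDegreeZero 𝒜 : 𝔞 →ₗ[ℂ] degreeZero 𝒜) := by
    refine iSup₂_le fun r hr y hy => ?_
    refine toDegreeZero_eq_zero 𝒜 ?_ hy
    rintro rfl
    exact hn (by simpa using hr.symm)
  exact h hx

variable {𝒜} [FiniteDimensional ℂ (𝒜 0)] [LieAlgebra.IsSemisimple ℂ (degreeZero 𝒜)]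
  {H : LieSubalgebra ℂ (degreeZero 𝒜)} [H.IsCartanSubalgebra]
  (b : (LieAlgebra.IsKilling.rootSystem H).Base)

/-- The `ℤ^ℓ`-graded `𝔞`-module `V(λ, r)`: the `𝔤`-module `V(λ)` placed in degree `r ∈ ℤ^ℓ`, on which
`𝔞₊` acts by zero. -/
def evG (wt : Module.Dual ℂ H) (r : Fin l → ℤ) : GradedRep (inclusion l) 𝒜 :=
  concentratedAt (toDegreeZero 𝒜)
    (fun i _ hx hi => toDegreeZero_eq_zero 𝒜 (fun h => hi (by rw [h, map_zero])) hx)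
    (HWModule b wt) r

/-- The `ℤ`-graded `𝒟(𝔞)`-module `V(λ, r)`: the `𝔤`-module `V(λ)` placed in degree `r ∈ ℤ`, on which
`𝔞₊` acts by zero. -/
def evD (wt : Module.Dual ℂ H) (r : ℤ) :
    GradedRep (Nat.castAddMonoidHom ℤ) (totalGrading 𝒜) :=
  concentratedAt (toDegreeZero 𝒜)
    (fun n _ hx hn => toDegreeZero_eq_zero_of_mem_totalGrading 𝒜
      (fun h => hn (by rw [h, map_zero])) hx)
    (HWModule b wt) r

end Multigraded

end MultigradedLie

end

/-! In a simple graded module, choose a nonzero homogeneous vector, of degree `r` say. Since `𝔞`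
only raises the total degree, the pieces of larger total degree span a graded submodule missing that
vector, hence zero. So the piece of degree `r` is itself a submodule and is everything
(`exists_piece_eq_top`), `𝔞₊` acts by zero, and the module is a finite-dimensional irreducible
`𝔤`-module placed in degree `r`. The argument needs only an additive degree that is positive on the
nonzero degrees of `𝔞`, so one theorem, `existsUnique_iso_concentratedAt`, serves both categories.

It remains to classify these `𝔤`-modules by dominant weights (`existsUnique_dominantWeight`). The
device is a single `h` in the Cartan subalgebra on which each root takes its height as value. In a
module generated by a highest weight vector `v` of weight `λ`, words in negative root vectors
applied to `v` show that `h` has eigenvalue `λ(h)` on the line of `v` only, the rest being spanned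
by eigenvectors for `λ(h) - 1, λ(h) - 2, …`. Hence a proper submodule lies in these lower
eigenspaces, a sum of proper submodules is proper, and the highest weight is unique. PBW is never
used: that the Verma module is nonzero is deduced from the irreducible module at hand. -/

noncomputable section

namespace MultigradedLie

/-! ### Separating the eigenvalue `c` from `c - 1, c - 2, …` by polynomials in one operator. -/

section Eigenspaces

open Polynomial

variable {M : Type*} [AddCommGroup M] [Module ℂ M]

/-- The sum of the eigenspaces of `T` for the eigenvalues `c - 1, c - 2, …`. -/
def lowerEigenspaces (T : Module.End ℂ M) (c : ℂ) : Submodule ℂ M :=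
  ⨆ n : ℕ, T.eigenspace (c - (n + 1))

variable {T : Module.End ℂ M} {c : ℂ}

theorem aeval_apply_of_apply_eq_smul {v : M} (hv : T v = c • v) (p : ℂ[X]) :
    aeval T p v = p.eval c • v := by
  by_cases h : v = 0
  · simp [h]
  · exact Module.End.aeval_apply_of_hasEigenvector (Module.End.hasEigenvector_iff.2
      ⟨Module.End.mem_eigenspace_iff.2 hv, h⟩)

theorem exists_aeval_eq_zero_of_apply_eq_smul {m : M} {a : ℂ} (hm : T m = a • m) (hc : c ≠ a) :
    ∃ p : ℂ[X], aeval T p m = 0 ∧ p.eval c ≠ 0 :=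
  ⟨X - C a, by rw [aeval_apply_of_apply_eq_smul hm]; simp, by simpa [sub_eq_zero] using hc⟩

/-- The product of the two polynomials kills both vectors and still does not vanish at `c`. -/
theorem exists_aeval_add_eq_zero {x y : M} (hx : ∃ p : ℂ[X], aeval T p x = 0 ∧ p.eval c ≠ 0)
    (hy : ∃ p : ℂ[X], aeval T p y = 0 ∧ p.eval c ≠ 0) :
    ∃ p : ℂ[X], aeval T p (x + y) = 0 ∧ p.eval c ≠ 0 := by
  obtain ⟨p, hp, hp'⟩ := hx
  obtain ⟨q, hq, hq'⟩ := hy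
  refine ⟨p * q, ?_, by simp [hp', hq']⟩
  rw [map_add, map_mul, Module.End.mul_apply, Module.End.mul_apply, hq, map_zero, add_zero,
    ← Module.End.mul_apply, ← map_mul, mul_comm, map_mul, Module.End.mul_apply, hp, map_zero]

theorem exists_aeval_eq_zero_of_mem_lowerEigenspaces {m : M} (hm : m ∈ lowerEigenspaces T c) :
    ∃ p : ℂ[X], aeval T p m = 0 ∧ p.eval c ≠ 0 := by
  induction hm using Submodule.iSup_induction' with
  | mem n m hm =>
    refine exists_aeval_eq_zero_of_apply_eq_smul (Module.End.mem_eigenspace_iff.1 hm) ?_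
    intro h
    exact Nat.cast_add_one_ne_zero (R := ℂ) n (by linear_combination h)
  | zero => exact ⟨1, by simp, by simp⟩
  | add x y _ _ hx hy => exact exists_aeval_add_eq_zero hx hy

theorem aeval_apply_mem {W : Submodule ℂ M} (hW : ∀ w ∈ W, T w ∈ W) (p : ℂ[X]) {w : M}
    (hw : w ∈ W) : aeval T p w ∈ W := by
  induction p using Polynomial.induction_on' with
  | add p q hp hq => simpa using W.add_mem hp hq
  | monomial n a =>
    have h : ∀ n : ℕ, (T ^ n) w ∈ W := fun n => by
      induction n with
      | zero => simpa
      | succ n ih => rw [pow_succ', Module.End.mul_apply]; exact hW _ ih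
    simpa [aeval_monomial, Module.algebraMap_end_apply] using W.smul_mem a (h n)

/-- A polynomial in `T` that kills `m` but has `p(c) ≠ 0` sends `v + m` to `p(c) • v`, which stays
in the `T`-stable `W`. -/
theorem mem_of_add_mem_of_mem_lowerEigenspaces {W : Submodule ℂ M} (hW : ∀ w ∈ W, T w ∈ W)
    {v m : M} (hv : T v = c • v) (hm : m ∈ lowerEigenspaces T c) (h : v + m ∈ W) : v ∈ W := by
  obtain ⟨p, hp, hp'⟩ := exists_aeval_eq_zero_of_mem_lowerEigenspaces hm
  have := aeval_apply_mem hW p h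
  rw [map_add, hp, add_zero, aeval_apply_of_apply_eq_smul hv] at this
  exact (W.smul_mem_iff hp').1 this

theorem eq_zero_of_mem_lowerEigenspaces {v : M} (hv : T v = c • v)
    (hm : v ∈ lowerEigenspaces T c) : v = 0 := by
  have := mem_of_add_mem_of_mem_lowerEigenspaces (W := ⊥) (T := T) (m := -v) (by simp) hv
    (neg_mem hm) (by simp)
  simpa using this

theorem mem_lowerEigenspaces {m : M} (n : ℕ) (hm : T m = (c - (n + 1)) • m) :
    m ∈ lowerEigenspaces T c :=
  Submodule.mem_iSup_of_mem n (Module.End.mem_eigenspace_iff.2 hm)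

/-- If `M` is spanned by a `c`-eigenvector and the lower eigenspaces, then all eigenvalues lie in
`c - ℕ`. -/
theorem exists_nat_of_apply_eq_smul {v : M} (hv : T v = c • v)
    (h : ℂ ∙ v ⊔ lowerEigenspaces T c = ⊤) {w : M} (hw : w ≠ 0) {d : ℂ} (hwd : T w = d • w) :
    ∃ n : ℕ, d = c - n := by
  -- Otherwise every vector is killed by a polynomial in `T` not vanishing at `d`, which is
  -- impossible for a `d`-eigenvector.
  by_contra! hd
  have key : ∀ m : M, ∃ p : ℂ[X], aeval T p m = 0 ∧ p.eval d ≠ 0 := by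
    intro m
    obtain ⟨x, hx, y, hy, rfl⟩ := Submodule.mem_sup.1 (h ▸ Submodule.mem_top : m ∈ _)
    obtain ⟨a, rfl⟩ := Submodule.mem_span_singleton.1 hx
    refine exists_aeval_add_eq_zero (exists_aeval_eq_zero_of_apply_eq_smul (a := c) ?_ ?_) ?_
    · rw [map_smul, hv, smul_comm]
    · simpa using hd 0
    induction hy using Submodule.iSup_induction' with
    | mem n m hm =>
      exact exists_aeval_eq_zero_of_apply_eq_smul (Module.End.mem_eigenspace_iff.1 hm)
        (by simpa using hd (n + 1))
    | zero => exact ⟨1, by simp, by simp⟩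
    | add x y _ _ hx hy => exact exists_aeval_add_eq_zero hx hy
  obtain ⟨p, hp, hp'⟩ := key w
  rw [aeval_apply_of_apply_eq_smul hwd] at hp
  exact (smul_ne_zero hp' hw) hp

end Eigenspaces

/-! ### Highest weight vectors and the grading by height. -/

section HighestWeight

variable {L : Type*} [LieRing L] [LieAlgebra ℂ L] [FiniteDimensional ℂ L]
  [LieAlgebra.IsSemisimple ℂ L] {H : LieSubalgebra ℂ L} [H.IsCartanSubalgebra]
  (b : (LieAlgebra.IsKilling.rootSystem H).Base)
  {M : Type*} [AddCommGroup M] [Module ℂ M] [LieRingModule L M] [LieModule ℂ L M]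

open LieAlgebra LieAlgebra.IsKilling

/-- An element of the Cartan subalgebra on which every root takes its height as value. -/
theorem exists_apply_eq_height :
    ∃ h : H, ∀ α : H.root, (α : LieModule.Weight ℂ H L) h = b.height α := by
  -- The functional with value 1 on every simple root; reflexivity of `H` turns it into an element
  -- of `H`.
  let f : Module.Dual ℂ (Module.Dual ℂ H) := b.toWeightBasis.constr ℂ fun _ => (1 : ℂ)
  refine ⟨(Module.evalEquiv ℂ H).symm f, fun α => ?_⟩
  obtain ⟨g, -, -, hg⟩ := b.exists_root_eq_sum_int α
  rw [RootPairing.Base.height_eq_sum hg]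
  have h1 : (α : LieModule.Weight ℂ H L) ((Module.evalEquiv ℂ H).symm f) =
      f ((rootSystem H).root α) := by
    rw [← Module.apply_evalEquiv_symm_apply]; rfl
  rw [h1, hg, map_sum, Int.cast_sum]
  refine Finset.sum_congr rfl fun j hj => ?_
  have : f ((rootSystem H).root j) = 1 := by
    have := b.toWeightBasis.constr_basis ℂ (fun _ => (1 : ℂ)) ⟨j, hj⟩
    rwa [RootPairing.Base.toWeightBasis_apply] at this
  rw [map_zsmul, this]
  simp

omit [IsSemisimple ℂ L] in
theorem forall_of_cartan_of_root {p : L → Prop} (hadd : ∀ x y, p x → p y → p (x + y))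
    (hH : ∀ h : H, p h)
    (hroot : ∀ α : H.root, ∀ x ∈ rootSpace H (α : LieModule.Weight ℂ H L), p x) (x : L) : p x := by
  have hx : x ∈ ⨆ χ : LieModule.Weight ℂ H L, LieModule.genWeightSpace L χ := by
    rw [LieModule.iSup_genWeightSpace_eq_top' ℂ H L]; trivial
  induction hx using LieSubmodule.iSup_induction' with
  | mem χ x hx =>
    by_cases hχ : χ.IsZero
    · rw [hχ] at hx
      have hx' : x ∈ H.toLieSubmodule := by rwa [← rootSpace_zero_eq ℂ L H]
      exact hH ⟨x, hx'⟩
    · exact hroot ⟨χ, by simpa using hχ⟩ x hx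
  | zero => exact hH 0
  | add x y _ _ hx hy => exact hadd x y hx hy

/-- `v` is annihilated by the positive root spaces and `H` acts on it through `wt`. -/
structure IsHighestWeightVector (wt : Module.Dual ℂ H) (v : M) : Prop where
  lie_cartan : ∀ h : H, ⁅(h : L), v⁆ = wt h • v
  lie_pos : ∀ α : H.root, b.IsPos α → ∀ x ∈ rootSpace H (α : LieModule.Weight ℂ H L), ⁅x, v⁆ = 0

/-- The vectors `y₁ ⋯ yₖ v` with every `yᵢ` in a negative root space. -/
inductive NegativeWord (v : M) : M → Prop
  | base : NegativeWord v v
  | lie (α : H.root) (hα : ¬ b.IsPos α) (y : L)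
      (hy : y ∈ rootSpace H (α : LieModule.Weight ℂ H L)) (m : M) (hm : NegativeWord v m) :
      NegativeWord v ⁅y, m⁆

variable {b} {wt : Module.Dual ℂ H} {v : M}

theorem lie_mem_span_negativeWord {α : H.root} (hα : ¬ b.IsPos α) {y : L}
    (hy : y ∈ rootSpace H (α : LieModule.Weight ℂ H L)) {m : M}
    (hm : m ∈ Submodule.span ℂ {m | NegativeWord b v m}) :
    ⁅y, m⁆ ∈ Submodule.span ℂ {m | NegativeWord b v m} := by
  induction hm using Submodule.span_induction with
  | mem m hm => exact Submodule.subset_span (.lie α hα y hy m hm)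
  | zero => simp
  | add m n _ _ hm hn => rw [lie_add]; exact add_mem hm hn
  | smul a m _ hm => rw [lie_smul]; exact Submodule.smul_mem _ _ hm

/-- Induction on the word, for all `z` at once: in `⁅z, ⁅y, m⁆⁆ = ⁅⁅z, y⁆, m⁆ + ⁅y, ⁅z, m⁆⁆` both
terms use the hypothesis for `m`, with `⁅z, y⁆` and with `z`. No reordering of words is required. -/
theorem IsHighestWeightVector.lie_negativeWord_mem (hv : IsHighestWeightVector b wt v) {m : M}
    (hm : NegativeWord b v m) (z : L) : ⁅z, m⁆ ∈ Submodule.span ℂ {m | NegativeWord b v m} := by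
  induction hm generalizing z with
  | base =>
    refine forall_of_cartan_of_root (H := H)
      (p := fun z => ⁅z, v⁆ ∈ Submodule.span ℂ {m | NegativeWord b v m}) (fun x y hx hy => ?_) (fun h => ?_)
      (fun α x hx => ?_) z
    · rw [add_lie]; exact add_mem hx hy
    · rw [hv.lie_cartan]; exact Submodule.smul_mem _ _ (Submodule.subset_span .base)
    · by_cases hα : b.IsPos α
      · rw [hv.lie_pos α hα x hx]; exact zero_mem _
      · exact Submodule.subset_span (.lie α hα x hx v .base)
  | lie α hα y hy m hm ih =>
    rw [leibniz_lie]
    exact add_mem (ih _) (lie_mem_span_negativeWord hα hy (ih z))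

theorem IsHighestWeightVector.span_negativeWord_eq_top (hv : IsHighestWeightVector b wt v)
    (hgen : ∀ N : LieSubmodule ℂ L M, v ∈ N → N = ⊤) :
    Submodule.span ℂ {m | NegativeWord b v m} = ⊤ := by
  let N : LieSubmodule ℂ L M :=
    { Submodule.span ℂ {m | NegativeWord b v m} with
      lie_mem := fun {x m} hm => by
        change m ∈ Submodule.span ℂ {m | NegativeWord b v m} at hm
        change ⁅x, m⁆ ∈ Submodule.span ℂ {m | NegativeWord b v m}
        induction hm using Submodule.span_induction with
        | mem m hm => exact hv.lie_negativeWord_mem hm x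
        | zero => simp
        | add m n _ _ hm hn => rw [lie_add]; exact add_mem hm hn
        | smul a m _ hm => rw [lie_smul]; exact Submodule.smul_mem _ _ hm }
  have hN : N = ⊤ := hgen N (Submodule.subset_span .base)
  have := congrArg LieSubmodule.toSubmodule hN
  simpa [N] using this

/-- A root that is not positive has height `-(k + 1)`, so `y` moves the eigenvalue `c - n` to `c -
(n + k + 1)`. The case `n = 0` covers the highest weight vector itself. -/
theorem lie_mem_lowerEigenspaces {h : H} {α : H.root} (hα : ¬ b.IsPos α)
    (hh : ∀ α : H.root, (α : LieModule.Weight ℂ H L) h = b.height α) {y : L}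
    (hy : y ∈ rootSpace H (α : LieModule.Weight ℂ H L)) {c : ℂ} (n : ℕ) {m : M}
    (hm : ⁅(h : L), m⁆ = (c - n) • m) :
    ⁅y, m⁆ ∈ lowerEigenspaces (LieModule.toEnd ℂ L M h) c := by
  have hneg : b.height α < 0 := by
    have := b.height_ne_zero α
    rw [RootPairing.Base.isPos_iff] at hα
    lia
  obtain ⟨k, hk⟩ : ∃ k : ℕ, b.height α = -((k : ℤ) + 1) :=
    ⟨(-b.height α - 1).toNat, by lia⟩
  have hhy : ⁅(h : L), y⁆ = (α : LieModule.Weight ℂ H L) h • y :=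
    lie_eq_smul_of_mem_rootSpace hy h
  refine mem_lowerEigenspaces (n + k) ?_
  rw [LieModule.toEnd_apply_apply, leibniz_lie, hhy, hm, hh, hk, smul_lie, lie_smul, ← add_smul]
  congr 1
  push_cast
  ring

theorem IsHighestWeightVector.span_sup_lowerEigenspaces_eq_top (hv : IsHighestWeightVector b wt v)
    (hgen : ∀ N : LieSubmodule ℂ L M, v ∈ N → N = ⊤) {h : H}
    (hh : ∀ α : H.root, (α : LieModule.Weight ℂ H L) h = b.height α) :
    ℂ ∙ v ⊔ lowerEigenspaces (LieModule.toEnd ℂ L M h) (wt h) = ⊤ := by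
  rw [eq_top_iff, ← hv.span_negativeWord_eq_top hgen, Submodule.span_le]
  intro m hm
  induction hm with
  | base => exact Submodule.mem_sup_left (Submodule.mem_span_singleton_self v)
  | lie α hα y hy m _ ih =>
    refine Submodule.mem_sup_right ?_
    obtain ⟨x, hx, m', hm', hxm⟩ := Submodule.mem_sup.1 ih
    obtain ⟨a, rfl⟩ := Submodule.mem_span_singleton.1 hx
    rw [← hxm]
    clear hxm ih
    rw [lie_add, lie_smul]
    refine add_mem (Submodule.smul_mem _ _
      (lie_mem_lowerEigenspaces hα hh hy 0 (by simp [hv.lie_cartan]))) ?_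
    induction hm' using Submodule.iSup_induction' with
    | mem n m' hm' =>
      refine lie_mem_lowerEigenspaces hα hh hy (n + 1) ?_
      simpa using Module.End.mem_eigenspace_iff.1 hm'
    | zero => simp
    | add p q _ _ hp hq => rw [lie_add]; exact add_mem hp hq

/-- A proper submodule of a highest weight module misses the highest weight space. -/
theorem IsHighestWeightVector.le_lowerEigenspaces (hv : IsHighestWeightVector b wt v)
    (hgen : ∀ N : LieSubmodule ℂ L M, v ∈ N → N = ⊤) {h : H}
    (hh : ∀ α : H.root, (α : LieModule.Weight ℂ H L) h = b.height α)
    {N : LieSubmodule ℂ L M} (hN : N ≠ ⊤) :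
    (N : Submodule ℂ M) ≤ lowerEigenspaces (LieModule.toEnd ℂ L M h) (wt h) := by
  intro m hm
  have hm' : m ∈ ℂ ∙ v ⊔ lowerEigenspaces (LieModule.toEnd ℂ L M h) (wt h) := by
    rw [hv.span_sup_lowerEigenspaces_eq_top hgen hh]; trivial
  obtain ⟨x, hx, m', hlow, rfl⟩ := Submodule.mem_sup.1 hm'
  obtain ⟨a, rfl⟩ := Submodule.mem_span_singleton.1 hx
  -- Stability of `N` under `h` isolates the component along `v`; if `a ≠ 0`, then `N` contains the
  -- generator.
  have hav : a • v ∈ (N : Submodule ℂ M) :=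
    mem_of_add_mem_of_mem_lowerEigenspaces (T := LieModule.toEnd ℂ L M h) (c := wt h)
      (fun w hw => N.lie_mem hw)
      (by rw [LieModule.toEnd_apply_apply, lie_smul, hv.lie_cartan, smul_comm]) hlow hm
  by_cases ha : a = 0
  · simpa [ha] using hlow
  · exact absurd (hgen N (((N : Submodule ℂ M).smul_mem_iff ha).1 hav)) hN

/-- The highest weight of a highest weight module is unique. -/
theorem IsHighestWeightVector.weight_eq (hv : IsHighestWeightVector b wt v)
    (hgen : ∀ N : LieSubmodule ℂ L M, v ∈ N → N = ⊤) {wt' : Module.Dual ℂ H} {v' : M}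
    (hv' : IsHighestWeightVector b wt' v')
    (hgen' : ∀ N : LieSubmodule ℂ L M, v' ∈ N → N = ⊤) [Nontrivial M] : wt = wt' := by
  obtain ⟨h, hh⟩ := exists_apply_eq_height b
  have ne : ∀ u : M, (∀ N : LieSubmodule ℂ L M, u ∈ N → N = ⊤) → u ≠ 0 := by
    rintro u hu rfl
    exact bot_ne_top (hu ⊥ (zero_mem _))
  have htop := hv.span_sup_lowerEigenspaces_eq_top hgen hh
  obtain ⟨n, hn⟩ := exists_nat_of_apply_eq_smul (T := LieModule.toEnd ℂ L M h)
    (hv.lie_cartan h) htop (ne v' hgen') (hv'.lie_cartan h)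
  obtain ⟨k, hk⟩ := exists_nat_of_apply_eq_smul (T := LieModule.toEnd ℂ L M h)
    (hv'.lie_cartan h) (hv'.span_sup_lowerEigenspaces_eq_top hgen' hh) (ne v hgen) (hv.lie_cartan h)
  -- Each of `wt h`, `wt' h` is the other minus a natural number, so they coincide.
  have hnk : ((n + k : ℕ) : ℂ) = 0 := by
    push_cast
    linear_combination hn + hk
  have hn0 : n = 0 := by
    have := Nat.cast_eq_zero.1 hnk
    lia
  subst hn0
  obtain ⟨x, hx, m, hm, hxm⟩ := Submodule.mem_sup.1 (htop ▸ Submodule.mem_top : v' ∈ _)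
  obtain ⟨a, rfl⟩ := Submodule.mem_span_singleton.1 hx
  -- `m = v' - a • v` has eigenvalue `wt h` and lies in the lower eigenspaces. Thus `v'` is a
  -- multiple of `v`, and all of `H` acts on both by the same weight.
  have hm0 : m = 0 := by
    refine eq_zero_of_mem_lowerEigenspaces ?_ hm
    have : m = v' - a • v := by rw [← hxm]; abel
    have hwt : wt' h = wt h := by simpa using hn
    rw [this, LieModule.toEnd_apply_apply, lie_sub, lie_smul, hv.lie_cartan, hv'.lie_cartan, hwt,
      smul_sub, smul_comm]
  rw [hm0, add_zero] at hxm
  ext t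
  have h1 := hv'.lie_cartan t
  rw [← hxm, lie_smul, hv.lie_cartan, smul_comm, hxm] at h1
  exact smul_left_injective ℂ (ne v' hgen') h1

end HighestWeight

/-! ### Existence and dominance of a highest weight in finite dimension. -/

section Dominant

variable {L : Type*} [LieRing L] [LieAlgebra ℂ L] [FiniteDimensional ℂ L]
  [LieAlgebra.IsSemisimple ℂ L] {H : LieSubalgebra ℂ L} [H.IsCartanSubalgebra]
  (b : (LieAlgebra.IsKilling.rootSystem H).Base)
  {M : Type*} [AddCommGroup M] [Module ℂ M] [LieRingModule L M] [LieModule ℂ L M]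

open LieAlgebra LieAlgebra.IsKilling

variable (M) in
theorem exists_isHighestWeightVector [FiniteDimensional ℂ M] [Nontrivial M] :
    ∃ (wt : Module.Dual ℂ H) (v : M), v ≠ 0 ∧ IsHighestWeightVector b wt v := by
  obtain ⟨h, hh⟩ := exists_apply_eq_height b
  have : Nonempty (LieModule.Weight ℂ H M) := by
    by_contra! contra
    simpa only [iSup_of_empty, bot_ne_top] using LieModule.iSup_genWeightSpace_eq_top' ℂ H M
  -- Weights are complex-valued, so they are compared by the real part at `h`; a positive root
  -- vector raises it by a positive height.
  obtain ⟨χ, hχ⟩ := Finite.exists_max fun χ : LieModule.Weight ℂ H M => (χ h).re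
  obtain ⟨v, hv0, hv⟩ := LieModule.exists_forall_lie_eq_smul ℂ H M χ
  refine ⟨χ.toLinear, v, hv0, fun t => hv t, fun α hα x hx => ?_⟩
  by_contra hne
  have hvχ : v ∈ LieModule.genWeightSpace M χ :=
    LieModule.weightSpace_le_genWeightSpace M χ ((LieModule.mem_weightSpace χ v).2 hv)
  have hmem := lie_mem_genWeightSpace_of_mem_genWeightSpace hx hvχ
  let χ' : LieModule.Weight ℂ H M := ⟨_, fun hbot => hne (by rw [hbot] at hmem; simpa using hmem)⟩
  have hlt := hχ χ'
  have hval : χ' h = (b.height α : ℂ) + χ h := by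
    rw [← hh]; rfl
  have hpos : (0 : ℝ) < b.height α := Int.cast_pos.2 hα
  simp only [hval, Complex.add_re, Complex.intCast_re] at hlt
  linarith

variable {b} {wt : Module.Dual ℂ H} {v : M}

theorem IsHighestWeightVector.mem_dominantWeights [FiniteDimensional ℂ M]
    (hv : IsHighestWeightVector b wt v) (hv0 : v ≠ 0) : wt ∈ dominantWeights b := by
  have hnat : ∀ i : b.support, ∃ n : ℕ, wt (b.toCoweightBasis i) = n := by
    intro i
    have hi : (i.1 : LieModule.Weight ℂ H L).IsNonZero := (LieSubalgebra.isNonZero_coe_root i.1)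
    obtain ⟨h, e, f, ht, he, hf⟩ := exists_isSl2Triple_of_weight_isNonZero hi
    have hcoroot := ht.h_eq_coroot hi he hf
    -- For the `sl₂` of a simple root, `v` is primitive, and finite dimension makes its eigenvalue
    -- on the coroot a natural number.
    have P : ht.HasPrimitiveVectorWith v (wt (b.toCoweightBasis i)) :=
      { ne_zero := hv0
        lie_h := by
          rw [hcoroot, RootPairing.Base.toCoweightBasis_apply]
          exact hv.lie_cartan _
        lie_e := hv.lie_pos i.1 (RootPairing.Base.isPos_of_mem_support i.2) e he }
    exact P.exists_nat
  choose n hn using hnat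
  have hsum : wt = ∑ i, n i • fundamentalWeight b i := by
    refine b.toCoweightBasis.ext fun j => ?_
    rw [LinearMap.sum_apply, Finset.sum_eq_single j, hn]
    · simp only [LinearMap.smul_apply, fundamentalWeight, Module.Basis.coord_apply,
        Module.Basis.repr_self, Finsupp.single_eq_same, nsmul_one]
    · intro i _ hij
      simp only [LinearMap.smul_apply, fundamentalWeight, Module.Basis.coord_apply,
        Module.Basis.repr_self, Finsupp.single_eq_of_ne hij, smul_zero]
    · simp
  rw [hsum]
  exact sum_mem fun i _ => nsmul_mem (AddSubmonoid.subset_closure (Set.mem_range_self i)) _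

end Dominant

/-! ### Induction and submodules over the enveloping algebra. -/

section Enveloping

variable {L : Type u} [LieRing L] [LieAlgebra ℂ L]

theorem mkAlgHom_surjective :
    Function.Surjective (UniversalEnvelopingAlgebra.mkAlgHom ℂ L) :=
  RingCon.mkₐ_surjective _

/-- Induction principle for the universal enveloping algebra. -/
theorem enveloping_induction {p : UniversalEnvelopingAlgebra ℂ L → Prop}
    (algebraMap : ∀ a : ℂ, p (algebraMap ℂ _ a)) (ι : ∀ x : L, p (UniversalEnvelopingAlgebra.ι ℂ x))
    (mul : ∀ u w, p u → p w → p (u * w)) (add : ∀ u w, p u → p w → p (u + w))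
    (u : UniversalEnvelopingAlgebra ℂ L) : p u := by
  obtain ⟨t, rfl⟩ := mkAlgHom_surjective u
  induction t using TensorAlgebra.induction with
  | algebraMap a => rw [AlgHom.commutes]; exact algebraMap a
  | ι x => exact ι x
  | mul s t hs ht => rw [map_mul]; exact mul _ _ hs ht
  | add s t hs ht => rw [map_add]; exact add _ _ hs ht

variable {M : Type*} [AddCommGroup M] [Module ℂ M] [LieRingModule L M] [LieModule ℂ L M]
  [Module (UniversalEnvelopingAlgebra ℂ L) M] [IsScalarTower ℂ (UniversalEnvelopingAlgebra ℂ L) M]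

omit [LieModule ℂ L M] in
theorem enveloping_smul_mem
    (hM : ∀ (x : L) (m : M), ⁅x, m⁆ = UniversalEnvelopingAlgebra.ι ℂ x • m) (N : LieSubmodule ℂ L M)
    (u : UniversalEnvelopingAlgebra ℂ L) : ∀ m ∈ N, u • m ∈ N := by
  induction u using enveloping_induction with
  | algebraMap a => intro m hm; rw [algebraMap_smul]; exact N.smul_mem a hm
  | ι x => intro m hm; rw [← hM]; exact N.lie_mem hm
  | mul u w hu hw => intro m hm; rw [mul_smul]; exact hu _ (hw _ hm)
  | add u w hu hw => intro m hm; rw [add_smul]; exact add_mem (hu _ hm) (hw _ hm)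

/-- A submodule over the enveloping algebra as a Lie submodule. -/
def envelopingLieSubmodule
    (hM : ∀ (x : L) (m : M), ⁅x, m⁆ = UniversalEnvelopingAlgebra.ι ℂ x • m)
    (N : Submodule (UniversalEnvelopingAlgebra ℂ L) M) : LieSubmodule ℂ L M where
  __ := N.restrictScalars ℂ
  lie_mem {x m} hm := by rw [hM]; exact N.smul_mem _ hm

end Enveloping

/-! ### Verma modules, their irreducible quotients, and the classification. -/

section HWModule

variable {L : Type u} [LieRing L] [LieAlgebra ℂ L] [FiniteDimensional ℂ L]
  [LieAlgebra.IsSemisimple ℂ L] {H : LieSubalgebra ℂ L} [H.IsCartanSubalgebra]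
  {b : (LieAlgebra.IsKilling.rootSystem H).Base} {wt : Module.Dual ℂ H}

section

variable {M : Type*} [AddCommGroup M] [Module ℂ M] [LieRingModule L M] [LieModule ℂ L M]
  [Module (UniversalEnvelopingAlgebra ℂ L) M] [IsScalarTower ℂ (UniversalEnvelopingAlgebra ℂ L) M]
  (hM : ∀ (x : L) (m : M), ⁅x, m⁆ = UniversalEnvelopingAlgebra.ι ℂ x • m)
  (f : UniversalEnvelopingAlgebra ℂ L →ₗ[UniversalEnvelopingAlgebra ℂ L] M)

include hM

omit [FiniteDimensional ℂ L] [LieAlgebra.IsSemisimple ℂ L] [LieModule ℂ L M] in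
theorem eq_top_of_apply_one_mem (hf : Function.Surjective f) (N : LieSubmodule ℂ L M)
    (hN : f 1 ∈ N) : N = ⊤ := by
  rw [eq_top_iff]
  intro m _
  obtain ⟨u, rfl⟩ := hf m
  rw [← mul_one u, ← smul_eq_mul, map_smul]
  exact enveloping_smul_mem hM N u _ hN

-- The universal property of the Verma module: `f u = u • f 1`, so killing the generators of the
-- ideal is a condition on `f 1` alone.
omit [LieModule ℂ L M] in
theorem vermaIdeal_le_ker_iff :
    vermaIdeal b wt ≤ LinearMap.ker f ↔ IsHighestWeightVector b wt (f 1) := by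
  have hf : ∀ u, f u = u • f 1 := fun u => by rw [← map_smul, smul_eq_mul, mul_one]
  constructor
  · intro h
    refine ⟨fun t => ?_, fun α hα x hx => ?_⟩
    · have : f _ = 0 := h (Submodule.subset_span (Or.inr ⟨t, rfl⟩))
      rw [hf, sub_smul, algebraMap_smul, sub_eq_zero] at this
      rw [hM, this]
    · have : f _ = 0 := h (Submodule.subset_span (Or.inl ⟨α, hα, x, hx, rfl⟩))
      rw [hM, ← hf, this]
  · intro h
    refine Submodule.span_le.2 ?_
    rintro _ (⟨α, hα, x, hx, rfl⟩ | ⟨t, rfl⟩)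
    · change f _ = 0
      rw [hf, ← hM, h.lie_pos α hα x hx]
    · change f _ = 0
      rw [hf, sub_smul, algebraMap_smul, ← hM, h.lie_cartan, sub_self]

end

variable (b wt) in
/-- The Verma module of highest weight `wt`. -/
def VermaModule : Type u := UniversalEnvelopingAlgebra ℂ L ⧸ vermaIdeal b wt

instance : AddCommGroup (VermaModule b wt) :=
  inferInstanceAs (AddCommGroup (UniversalEnvelopingAlgebra ℂ L ⧸ vermaIdeal b wt))

instance : Module ℂ (VermaModule b wt) :=
  inferInstanceAs (Module ℂ (UniversalEnvelopingAlgebra ℂ L ⧸ vermaIdeal b wt))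

instance : Module (UniversalEnvelopingAlgebra ℂ L) (VermaModule b wt) :=
  inferInstanceAs (Module (UniversalEnvelopingAlgebra ℂ L)
    (UniversalEnvelopingAlgebra ℂ L ⧸ vermaIdeal b wt))

instance : IsScalarTower ℂ (UniversalEnvelopingAlgebra ℂ L) (VermaModule b wt) :=
  inferInstanceAs (IsScalarTower ℂ (UniversalEnvelopingAlgebra ℂ L)
    (UniversalEnvelopingAlgebra ℂ L ⧸ vermaIdeal b wt))

instance : LieRingModule L (VermaModule b wt) where
  bracket x m := UniversalEnvelopingAlgebra.ι ℂ x • m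
  add_lie x y m := by
    rw [map_add, add_smul]
  lie_add x m n := smul_add (UniversalEnvelopingAlgebra.ι ℂ x) m n
  leibniz_lie x y m := by
    change UniversalEnvelopingAlgebra.ι ℂ x • UniversalEnvelopingAlgebra.ι ℂ y • m =
      UniversalEnvelopingAlgebra.ι ℂ ⁅x, y⁆ • m +
        UniversalEnvelopingAlgebra.ι ℂ y • UniversalEnvelopingAlgebra.ι ℂ x • m
    let : LieRing (UniversalEnvelopingAlgebra ℂ L) := LieRing.ofAssociativeRing
    rw [LieHom.map_lie, LieRing.of_associative_ring_bracket, sub_smul, mul_smul, mul_smul,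
      sub_add_cancel]

instance : LieModule ℂ L (VermaModule b wt) where
  smul_lie t x m := by
    change UniversalEnvelopingAlgebra.ι ℂ (t • x) • m =
      t • UniversalEnvelopingAlgebra.ι ℂ x • m
    rw [map_smul, smul_assoc]
  lie_smul t x m := by
    change UniversalEnvelopingAlgebra.ι ℂ x • t • m = t • UniversalEnvelopingAlgebra.ι ℂ x • m
    rw [← algebraMap_smul (UniversalEnvelopingAlgebra ℂ L) t m,
      ← algebraMap_smul (UniversalEnvelopingAlgebra ℂ L) t (_ • m), smul_smul, smul_smul,
      Algebra.commutes]

variable (b wt) in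
/-- The projection onto the Verma module. -/
def toVerma :
    UniversalEnvelopingAlgebra ℂ L →ₗ[UniversalEnvelopingAlgebra ℂ L] VermaModule b wt :=
  (vermaIdeal b wt).mkQ

variable (b wt) in
/-- The projection onto the irreducible highest weight module. -/
def toHWModule :
    UniversalEnvelopingAlgebra ℂ L →ₗ[UniversalEnvelopingAlgebra ℂ L] HWModule b wt :=
  (maximalIdeal b wt).mkQ

theorem toHWModule_surjective : Function.Surjective (toHWModule b wt) :=
  Submodule.mkQ_surjective _

/-- Each ideal in the supremum has a proper image in the Verma module, hence lands in the lower
eigenspaces. So does their sum, whereas the image of 1 is a nonzero vector of eigenvalue `wt t`. -/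
theorem maximalIdeal_ne_top (h : vermaIdeal b wt ≠ ⊤) : maximalIdeal b wt ≠ ⊤ := by
  obtain ⟨t, ht⟩ := exists_apply_eq_height b
  have hker : LinearMap.ker (toVerma b wt) = vermaIdeal b wt := Submodule.ker_mkQ _
  have hsurj : Function.Surjective (toVerma b wt) := Submodule.mkQ_surjective _
  have hM : ∀ (x : L) (m : VermaModule b wt), ⁅x, m⁆ = UniversalEnvelopingAlgebra.ι ℂ x • m :=
    fun _ _ => rfl
  have hv : IsHighestWeightVector b wt (toVerma b wt 1) :=
    (vermaIdeal_le_ker_iff hM _).1 hker.ge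
  have hgen := eq_top_of_apply_one_mem hM (toVerma b wt) hsurj
  have hlow : ∀ u ∈ maximalIdeal b wt,
      toVerma b wt u ∈ lowerEigenspaces (LieModule.toEnd ℂ L (VermaModule b wt) t) (wt t) := by
    intro u hu
    rw [maximalIdeal, sSup_eq_iSup'] at hu
    induction hu using Submodule.iSup_induction' with
    | mem J u hu =>
      obtain ⟨J, hJ, hJtop⟩ := J
      refine hv.le_lowerEigenspaces hgen ht
        (N := envelopingLieSubmodule hM (J.map (toVerma b wt))) ?_ ⟨u, hu, rfl⟩
      intro htop
      refine hJtop ((Ideal.eq_top_iff_one J).2 ?_)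
      have h1 : toVerma b wt 1 ∈ envelopingLieSubmodule hM (J.map (toVerma b wt)) := by
        rw [htop]; trivial
      obtain ⟨w, hw, hw1⟩ := h1
      -- The kernel of `toVerma` lies in `J`, so an element of `J` with the same image as 1 forces
      -- `1 ∈ J`.
      have : w - 1 ∈ J := hJ (by rw [← hker, LinearMap.mem_ker, map_sub, hw1, sub_self])
      simpa using J.sub_mem hw this
    | zero => simp
    | add u w _ _ hu hw => rw [map_add]; exact add_mem hu hw
  intro htop
  have h0 := eq_zero_of_mem_lowerEigenspaces (hv.lie_cartan t) (hlow 1 (htop ▸ Submodule.mem_top))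
  refine h ((Ideal.eq_top_iff_one (vermaIdeal b wt)).2 ?_)
  rw [← hker]
  exact h0

/-- If the ideal were everything, the supremum defining `maximalIdeal` would be empty and `HWModule`
would be `U(L)` itself. Its irreducibility forces the augmentation ideal to vanish, so `L` is zero
by semisimplicity; then the generators of `vermaIdeal` are all zero, a contradiction. -/
theorem HWModule.vermaIdeal_ne_top [LieModule.IsIrreducible ℂ L (HWModule b wt)] :
    vermaIdeal b wt ≠ ⊤ := by
  intro htop
  have hmax : maximalIdeal b wt = ⊥ := by
    rw [maximalIdeal, sSup_eq_bot]
    rintro J ⟨hJ, hJ'⟩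
    exact absurd (top_le_iff.1 (htop ▸ hJ)) hJ'
  have hM : ∀ (x : L) (m : HWModule b wt), ⁅x, m⁆ = UniversalEnvelopingAlgebra.ι ℂ x • m :=
    fun _ _ => rfl
  have hinj : Function.Injective (toHWModule b wt) := by
    rw [← LinearMap.ker_eq_bot, ← hmax]; exact Submodule.ker_mkQ _
  have hone : (1 : UniversalEnvelopingAlgebra ℂ L) ≠ 0 := by
    intro h1
    have hsub : ∀ m : HWModule b wt, m = 0 := fun m => by
      rw [← one_smul (UniversalEnvelopingAlgebra ℂ L) m, h1, zero_smul]
    exact bot_ne_top (α := LieSubmodule ℂ L (HWModule b wt)) (by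
      ext m; simp [hsub m])
  -- The augmentation; its kernel is a proper left ideal containing every `ι x`.
  let ε : UniversalEnvelopingAlgebra ℂ L →ₐ[ℂ] ℂ :=
    letI : LieRing ℂ := LieRing.ofAssociativeRing
    UniversalEnvelopingAlgebra.lift ℂ (0 : L →ₗ⁅ℂ⁆ ℂ)
  have hε : ∀ x, ε (UniversalEnvelopingAlgebra.ι ℂ x) = 0 := fun x =>
    UniversalEnvelopingAlgebra.lift_ι_apply ℂ _ x
  let J : Submodule (UniversalEnvelopingAlgebra ℂ L) (UniversalEnvelopingAlgebra ℂ L) :=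
    RingHom.ker ε
  have hJ : ∀ u ∈ J, u = 0 := by
    intro u hu
    refine hinj ?_
    rw [map_zero]
    rcases IsSimpleOrder.eq_bot_or_eq_top (envelopingLieSubmodule hM (J.map (toHWModule b wt)))
      with h | h
    · have : toHWModule b wt u ∈ envelopingLieSubmodule hM (J.map (toHWModule b wt)) :=
        ⟨u, hu, rfl⟩
      rw [h] at this
      simpa using this
    · have h1 : toHWModule b wt 1 ∈ envelopingLieSubmodule hM (J.map (toHWModule b wt)) := by
        rw [h]; trivial
      obtain ⟨w, hw, hw1⟩ := h1
      have hw' : ε w = 0 := hw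
      rw [hinj hw1, map_one] at hw'
      exact absurd hw' one_ne_zero
  have hι : ∀ x : L, UniversalEnvelopingAlgebra.ι ℂ x = 0 := fun x => hJ _ (hε x)
  have hL : ∀ x : L, x = 0 := by
    intro x
    have h1 : LieModule.toEnd ℂ L L x = 0 := by
      rw [← UniversalEnvelopingAlgebra.lift_ι_apply ℂ (LieModule.toEnd ℂ L L) x, hι, map_zero]
    have h2 : x ∈ LieAlgebra.center ℂ L := by
      rw [LieModule.mem_maxTrivSubmodule]
      intro y
      rw [← lie_skew, ← LieModule.toEnd_apply_apply ℂ, h1, LinearMap.zero_apply, neg_zero]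
    rw [LieAlgebra.center_eq_bot] at h2
    simpa using h2
  have hbot : vermaIdeal b wt ≤ ⊥ := by
    refine Submodule.span_le.2 ?_
    rintro _ (⟨α, hα, x, hx, rfl⟩ | ⟨t, rfl⟩)
    · simp [hι]
    · have : t = 0 := Subtype.ext (hL t)
      simp [hι, this]
  have : (1 : UniversalEnvelopingAlgebra ℂ L) ∈ vermaIdeal b wt := htop ▸ Submodule.mem_top
  exact hone (by simpa using hbot this)

theorem HWModule.isHighestWeightVector (h : vermaIdeal b wt ≠ ⊤) :
    IsHighestWeightVector b wt (toHWModule b wt 1) := by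
  refine (vermaIdeal_le_ker_iff (fun _ _ => rfl) _).1 ?_
  have hker : LinearMap.ker (toHWModule b wt) = maximalIdeal b wt := Submodule.ker_mkQ _
  rw [hker]
  exact le_sSup ⟨le_rfl, h⟩

theorem HWModule.eq_top_of_mem (N : LieSubmodule ℂ L (HWModule b wt))
    (hN : toHWModule b wt 1 ∈ N) : N = ⊤ :=
  eq_top_of_apply_one_mem (fun _ _ => rfl) _ toHWModule_surjective N hN

/-- An irreducible module with a highest weight vector is the irreducible highest weight module. -/
theorem IsHighestWeightVector.nonempty_equiv {M : Type*} [AddCommGroup M] [Module ℂ M]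
    [LieRingModule L M] [LieModule ℂ L M] [LieModule.IsIrreducible ℂ L M] {v : M} (hv0 : v ≠ 0)
    (hv : IsHighestWeightVector b wt v) : Nonempty (M ≃ₗ⁅ℂ, L⁆ HWModule b wt) := by
  let φ := UniversalEnvelopingAlgebra.lift ℂ (LieModule.toEnd ℂ L M)
  let : Module (UniversalEnvelopingAlgebra ℂ L) M := Module.compHom M φ.toRingHom
  have hsmul : ∀ (u : UniversalEnvelopingAlgebra ℂ L) (m : M), u • m = φ u m := fun _ _ => rfl
  have hM : ∀ (x : L) (m : M), ⁅x, m⁆ = UniversalEnvelopingAlgebra.ι ℂ x • m := by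
    intro x m
    rw [hsmul, UniversalEnvelopingAlgebra.lift_ι_apply]
    rfl
  have : IsScalarTower ℂ (UniversalEnvelopingAlgebra ℂ L) M :=
    ⟨fun a u m => by rw [hsmul, hsmul, map_smul]; rfl⟩
  let f : UniversalEnvelopingAlgebra ℂ L →ₗ[UniversalEnvelopingAlgebra ℂ L] M :=
    LinearMap.toSpanSingleton _ M v
  have hf1 : f 1 = v := one_smul _ v
  have htop : ∀ J : Submodule (UniversalEnvelopingAlgebra ℂ L) (UniversalEnvelopingAlgebra ℂ L),
      ∀ u ∈ J, f u ≠ 0 → ∀ m, ∃ w ∈ J, f w = m := by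
    intro J u hu hne m
    have hN : envelopingLieSubmodule hM (J.map f) = ⊤ := by
      refine (IsSimpleOrder.eq_bot_or_eq_top _).resolve_left fun hbot => hne ?_
      have : f u ∈ envelopingLieSubmodule hM (J.map f) := ⟨u, hu, rfl⟩
      rw [hbot] at this
      simpa using this
    have : m ∈ envelopingLieSubmodule hM (J.map f) := by rw [hN]; trivial
    exact this
  have hsurj : Function.Surjective f := fun m => by
    obtain ⟨w, -, hw⟩ := htop ⊤ 1 trivial (hf1 ▸ hv0) m
    exact ⟨w, hw⟩
  have hker_top : LinearMap.ker f ≠ ⊤ := fun h => hv0 (by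
    rw [← hf1]
    exact (h ▸ Submodule.mem_top : (1 : UniversalEnvelopingAlgebra ℂ L) ∈ LinearMap.ker f))
  have hverma : vermaIdeal b wt ≤ LinearMap.ker f :=
    (vermaIdeal_le_ker_iff hM f).2 (hf1 ▸ hv)
  have hle : LinearMap.ker f ≤ maximalIdeal b wt := le_sSup ⟨hverma, hker_top⟩
  have hker : LinearMap.ker f = maximalIdeal b wt := by
    -- If `maximalIdeal` had nonzero image in the irreducible `M`, it would contain some `w` with `f
    -- w = f 1`. As `w - 1` is in the kernel, which lies in `maximalIdeal`, so would be 1.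
    refine le_antisymm hle fun u hu => ?_
    by_contra hne
    refine maximalIdeal_ne_top (fun h => hker_top (top_le_iff.1 (h ▸ hverma)))
      ((Ideal.eq_top_iff_one (maximalIdeal b wt)).2 ?_)
    obtain ⟨w, hw, hw1⟩ := htop _ u hu hne (f 1)
    have : w - 1 ∈ LinearMap.ker f := by rw [LinearMap.mem_ker, map_sub, hw1, sub_self]
    simpa using Submodule.sub_mem _ hw (hle this)
  let e : HWModule b wt ≃ₗ[UniversalEnvelopingAlgebra ℂ L] M :=
    (Submodule.quotEquivOfEq _ _ hker.symm).trans (f.quotKerEquivOfSurjective hsurj)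
  let g : HWModule b wt ≃ₗ⁅ℂ, L⁆ M :=
    { e.restrictScalars ℂ with
      map_lie' := fun {x m} => by
        change e (UniversalEnvelopingAlgebra.ι ℂ x • m) = ⁅x, e m⁆
        rw [map_smul, hM] }
  exact ⟨g.symm⟩

variable (b) in
/-- Irreducible finite-dimensional modules are classified by their dominant highest weight. -/
theorem existsUnique_dominantWeight {M : Type*} [AddCommGroup M] [Module ℂ M]
    [LieRingModule L M] [LieModule ℂ L M] [FiniteDimensional ℂ M] [LieModule.IsIrreducible ℂ L M] :
    ∃! wt : dominantWeights b, Nonempty (M ≃ₗ⁅ℂ, L⁆ HWModule b wt) := by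
  have : Nontrivial M := (LieSubmodule.nontrivial_iff ℂ L M).1 inferInstance
  obtain ⟨wt, v, hv0, hv⟩ := exists_isHighestWeightVector b M
  refine ⟨⟨wt, hv.mem_dominantWeights hv0⟩, hv.nonempty_equiv hv0, ?_⟩
  rintro ⟨wt', hwt'⟩ ⟨e⟩
  refine Subtype.ext ?_
  change wt' = wt
  -- Irreducibility is transported from `M` along `e`, not derived from dominance of `wt'`.
  have : LieModule.IsIrreducible ℂ L (HWModule b wt') :=
    (LieSubmodule.orderIsoMapComap e.symm).isSimpleOrder
  have : Nontrivial (HWModule b wt') := (LieSubmodule.nontrivial_iff ℂ L _).1 inferInstance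
  have hev : IsHighestWeightVector b wt (e v) := by
    refine ⟨fun t => ?_, fun α hα x hx => ?_⟩
    · rw [← LieModuleEquiv.coe_toLieModuleHom, ← LieModuleHom.map_lie, hv.lie_cartan, map_smul]
    · rw [← LieModuleEquiv.coe_toLieModuleHom, ← LieModuleHom.map_lie, hv.lie_pos α hα x hx,
        map_zero]
  refine (HWModule.isHighestWeightVector HWModule.vermaIdeal_ne_top).weight_eq
    HWModule.eq_top_of_mem hev fun N hN => (IsSimpleOrder.eq_bot_or_eq_top N).resolve_left ?_
  rintro rfl
  exact hv0 (e.injective (((LieSubmodule.mem_bot _).1 hN).trans (map_zero e).symm))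

end HWModule

/-! ### Simple graded modules are concentrated in one degree. -/

section Graded

variable {I Γ : Type} [AddCommMonoid I] [AddCommGroup Γ] [DecidableEq Γ]
  {𝔞 : Type u} [LieRing 𝔞] [LieAlgebra ℂ 𝔞] {c : I →+ Γ} {𝒜 : I → Submodule ℂ 𝔞}

/-- A graded Lie submodule of a graded module. -/
def GradedRep.sub (V : GradedRep c 𝒜) (N : LieSubmodule ℂ 𝔞 V.carrier)
    (hN : (N : Submodule ℂ V.carrier) ≤ ⨆ s, (N : Submodule ℂ V.carrier) ⊓ V.piece s) :
    GradedRep c 𝒜 where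
  carrier := N
  piece s := (V.piece s).comap (N : Submodule ℂ V.carrier).subtype
  isInternal := by
    have hV := (DirectSum.isInternal_submodule_iff_iSupIndep_and_iSup_eq_top _).1 V.isInternal
    have hinj : Function.Injective (N : Submodule ℂ V.carrier).subtype := Subtype.val_injective
    rw [DirectSum.isInternal_submodule_iff_iSupIndep_and_iSup_eq_top]
    constructor
    · intro s
      rw [Submodule.disjoint_def]
      intro x hx hx'
      have hle : (⨆ t, ⨆ (_ : t ≠ s), (V.piece t).comap (N : Submodule ℂ V.carrier).subtype).map
          (N : Submodule ℂ V.carrier).subtype ≤ ⨆ t, ⨆ (_ : t ≠ s), V.piece t := by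
        simp only [Submodule.map_iSup]
        exact iSup₂_mono fun t _ => Submodule.map_comap_le _ _
      exact hinj ((Submodule.disjoint_def.1 (hV.1 s) _ hx
        (hle (Submodule.mem_map_of_mem hx'))).trans (map_zero _).symm)
    · rw [eq_top_iff]
      rw [← Submodule.map_le_map_iff_of_injective hinj, Submodule.map_iSup,
        Submodule.map_subtype_top]
      exact hN.trans (iSup_mono fun s => (Submodule.map_comap_subtype _ _).ge)
  lie_mem i s x v hx hv := V.lie_mem i s x v hx hv

variable {V : (hasFinitePieces c 𝒜).FullSubcategory}

theorem nontrivial_of_simple [Simple V] : Nontrivial V.obj.carrier := by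
  by_contra h
  rw [not_nontrivial_iff_subsingleton] at h
  refine id_nonzero V ?_
  ext
  refine GradedRep.Hom.ext (LieModuleHom.ext fun v => Subsingleton.elim _ _)

/-- The inclusion of a graded submodule is a monomorphism in the category, hence zero or an
isomorphism. -/
theorem eq_bot_or_eq_top_of_simple [Simple V] (N : LieSubmodule ℂ 𝔞 V.obj.carrier)
    (hN : (N : Submodule ℂ V.obj.carrier) ≤
      ⨆ s, (N : Submodule ℂ V.obj.carrier) ⊓ V.obj.piece s) : N = ⊥ ∨ N = ⊤ := by
  let W : (hasFinitePieces c 𝒜).FullSubcategory :=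
    ⟨V.obj.sub N hN, fun s => by
      have : FiniteDimensional ℂ (V.obj.piece s) := V.property s
      exact FiniteDimensional.of_injective
        (((N : Submodule ℂ V.obj.carrier).subtype).submoduleComap (V.obj.piece s))
        fun x y h => Subtype.ext (Subtype.ext (congrArg (fun z : V.obj.piece s => z.1) h))⟩
  let g : W.obj ⟶ V.obj := ⟨N.incl, fun s v hv => hv⟩
  let f : W ⟶ V := ObjectProperty.homMk g
  have : Mono f := by
    refine ⟨fun {Z} p q h => ?_⟩
    ext
    refine GradedRep.Hom.ext (LieModuleHom.ext fun z => ?_)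
    have := congrArg (fun k : Z ⟶ V => k.hom.toLieModuleHom z) h
    exact Subtype.ext this
  by_cases hf : f = 0
  · left
    rw [LieSubmodule.eq_bot_iff]
    intro v hv
    exact congrArg (fun k : W ⟶ V => k.hom.toLieModuleHom ⟨v, hv⟩) hf
  · right
    have : IsIso f := isIso_of_mono_of_nonzero hf
    rw [eq_top_iff]
    intro v _
    have h := congrArg (fun k : V ⟶ V => k.hom.toLieModuleHom v) (IsIso.inv_hom_id f)
    let n : N := (inv f).hom.toLieModuleHom v
    have h' : (n : V.obj.carrier) = v := h
    exact h' ▸ n.2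

/-- The sum of the pieces with degrees in an upward closed set is a submodule. -/
def GradedRep.upper (V : GradedRep c 𝒜) (h𝒜 : ⨆ i, 𝒜 i = ⊤) (S : Set Γ)
    (hS : ∀ i, ∀ s ∈ S, ∀ x ∈ 𝒜 i, ∀ v ∈ V.piece s, ⁅x, v⁆ ≠ 0 → c i + s ∈ S) :
    LieSubmodule ℂ 𝔞 V.carrier where
  __ := ⨆ s ∈ S, V.piece s
  lie_mem {x m} hm := by
    change m ∈ ⨆ s ∈ S, V.piece s at hm
    change ⁅x, m⁆ ∈ ⨆ s ∈ S, V.piece s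
    have hx : x ∈ ⨆ i, 𝒜 i := h𝒜 ▸ Submodule.mem_top
    induction hx using Submodule.iSup_induction' with
    | zero => simp
    | add x y _ _ hx hy => rw [add_lie]; exact add_mem hx hy
    | mem i x hx =>
      have hle : ⨆ s ∈ S, V.piece s ≤
          (⨆ s ∈ S, V.piece s).comap (LieModule.toEnd ℂ 𝔞 V.carrier x) := by
        refine iSup₂_le fun s hs v hv => ?_
        change ⁅x, v⁆ ∈ ⨆ s ∈ S, V.piece s
        by_cases h0 : ⁅x, v⁆ = 0
        · rw [h0]; exact zero_mem _
        · exact Submodule.mem_iSup_of_mem _ (Submodule.mem_iSup_of_mem (hS i s hs x hx v hv h0)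
            (V.lie_mem i s x v hx hv))
      exact hle hm

theorem upper_eq_bot_or_eq_top [Simple V] (h𝒜 : ⨆ i, 𝒜 i = ⊤) (S : Set Γ)
    (hS : ∀ i, ∀ s ∈ S, ∀ x ∈ 𝒜 i, ∀ v ∈ V.obj.piece s, ⁅x, v⁆ ≠ 0 → c i + s ∈ S) :
    V.obj.upper h𝒜 S hS = ⊥ ∨ V.obj.upper h𝒜 S hS = ⊤ := by
  refine eq_bot_or_eq_top_of_simple _ ?_
  change ⨆ s ∈ S, V.obj.piece s ≤ _
  refine iSup₂_le fun s hs => le_trans (le_inf ?_ le_rfl) (le_iSup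
    (fun s => (V.obj.upper h𝒜 S hS : Submodule ℂ V.obj.carrier) ⊓ V.obj.piece s) s)
  exact le_iSup₂ (f := fun s (_ : s ∈ S) => V.obj.piece s) s hs

theorem GradedRep.disjoint_upper (V : GradedRep c 𝒜) (h𝒜 : ⨆ i, 𝒜 i = ⊤) (S : Set Γ)
    (hS : ∀ i, ∀ s ∈ S, ∀ x ∈ 𝒜 i, ∀ v ∈ V.piece s, ⁅x, v⁆ ≠ 0 → c i + s ∈ S) {r : Γ}
    (hr : r ∉ S) : Disjoint (V.piece r) (V.upper h𝒜 S hS : Submodule ℂ V.carrier) :=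
  ((DirectSum.isInternal_submodule_iff_iSupIndep_and_iSup_eq_top _).1
    V.isInternal).1.disjoint_biSup hr

/-- `upper` is applied twice: to the degrees above `d r`, which gives zero because `v` is missed,
and then to `{r}` alone, which gives everything because `v` is contained. -/
theorem exists_piece_eq_top [Simple V] (h𝒜 : ⨆ i, 𝒜 i = ⊤) (d : Γ →+ ℤ) (hd : ∀ i, 0 ≤ d (c i))
    (hd0 : ∀ i, d (c i) = 0 → c i = 0) : ∃ r, V.obj.piece r = ⊤ := by
  have := nontrivial_of_simple (V := V)
  obtain ⟨r, v, hv, hv0⟩ : ∃ r, ∃ v ∈ V.obj.piece r, v ≠ 0 := by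
    by_contra! h
    have hbot : ⨆ s, V.obj.piece s = ⊥ := iSup_eq_bot.2 fun s => (Submodule.eq_bot_iff _).2 (h s)
    rw [V.obj.isInternal.submodule_iSup_eq_top] at hbot
    exact top_ne_bot hbot
  have hdisj : ∀ (S : Set Γ) (hS), r ∉ S → V.obj.upper h𝒜 S hS = ⊥ := by
    intro S hS hr
    refine (upper_eq_bot_or_eq_top h𝒜 S hS).resolve_right fun h => hv0 ?_
    refine Submodule.disjoint_def.1 (V.obj.disjoint_upper h𝒜 S hS hr) v hv ?_
    rw [h]; trivial
  have hzero : ∀ s, d r < d s → ∀ w ∈ V.obj.piece s, w = 0 := by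
    intro s hs w hw
    have hS : ∀ i, ∀ t ∈ {t | d r < d t}, ∀ x ∈ 𝒜 i, ∀ v ∈ V.obj.piece t, ⁅x, v⁆ ≠ 0 →
        c i + t ∈ {t | d r < d t} := fun i t ht x hx v hv _ => by
      have := hd i
      simp only [Set.mem_ofPred_eq, map_add] at ht ⊢
      lia
    have h := hdisj _ hS (by simp)
    have hw' : w ∈ V.obj.upper h𝒜 _ hS :=
      le_iSup₂ (f := fun s (_ : s ∈ {t | d r < d t}) => V.obj.piece s) s hs hw
    rw [h] at hw'
    simpa using hw'
  refine ⟨r, ?_⟩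
  -- Closure is required only for nonzero brackets: a bracket that changes the degree lands in a
  -- piece already known to vanish.
  have hS : ∀ i, ∀ s ∈ ({r} : Set Γ), ∀ x ∈ 𝒜 i, ∀ v ∈ V.obj.piece s, ⁅x, v⁆ ≠ 0 →
      c i + s ∈ ({r} : Set Γ) := by
    rintro i s rfl x hx v hv hne
    have hnlt : ¬ d s < d (c i + s) := fun hlt => hne (hzero _ hlt _ (V.obj.lie_mem i s x v hx hv))
    have : c i = 0 := hd0 i (by have := hd i; rw [map_add] at hnlt; lia)
    simp [this]
  have hmem : v ∈ V.obj.upper h𝒜 {r} hS :=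
    le_iSup₂ (f := fun s (_ : s ∈ ({r} : Set Γ)) => V.obj.piece s) r rfl hv
  have htop := (upper_eq_bot_or_eq_top h𝒜 {r} hS).resolve_left fun h => hv0 (by
    rw [h] at hmem; simpa using hmem)
  have := congrArg LieSubmodule.toSubmodule htop
  simpa [GradedRep.upper] using this

theorem GradedRep.eq_of_mem_of_mem (V : GradedRep c 𝒜) {r s : Γ} {v : V.carrier} (hv : v ≠ 0)
    (hr : v ∈ V.piece r) (hs : v ∈ V.piece s) : r = s := by
  by_contra h
  exact hv (Submodule.disjoint_def.1 (V.isInternal.submodule_iSupIndep.pairwiseDisjoint h) v hr hs)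

/-- Both actions factor through the surjection `π`, so `𝔞`-maps and `L`-maps agree; a nonzero vector
of `V` detects the degree. -/
theorem nonempty_iso_concentratedAt_iff {L : Type u} [LieRing L] [LieAlgebra ℂ L] {π : 𝔞 →ₗ⁅ℂ⁆ L}
    {hπ : ∀ (i : I) (x : 𝔞), x ∈ 𝒜 i → c i ≠ 0 → π x = 0}
    {M : Type u} [AddCommGroup M] [Module ℂ M] [LieRingModule L M] [LieModule ℂ L M] {s : Γ}
    (V : GradedRep c 𝒜) [Nontrivial V.carrier] [LieRingModule L V.carrier]
    (hV : ∀ (x : 𝔞) (v : V.carrier), ⁅x, v⁆ = ⁅π x, v⁆) (hsurj : Function.Surjective π) {r : Γ}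
    (hr : V.piece r = ⊤) :
    Nonempty (V ≅ concentratedAt π hπ M s) ↔ Nonempty (V.carrier ≃ₗ⁅ℂ, L⁆ M) ∧ s = r := by
  constructor
  · rintro ⟨e⟩
    let f : V.carrier → M := e.hom.toLieModuleHom
    let g : M → V.carrier := e.inv.toLieModuleHom
    have hgf : ∀ v, g (f v) = v := fun v =>
      congrArg (fun k : V ⟶ V => k.toLieModuleHom v) e.hom_inv_id
    have hfg : ∀ m, f (g m) = m := fun m =>
      congrArg (fun k : concentratedAt π hπ M s ⟶ concentratedAt π hπ M s => k.toLieModuleHom m)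
        e.inv_hom_id
    refine ⟨⟨{ toFun := f, map_add' := ?_, map_smul' := ?_, map_lie' := ?_, invFun := g
               left_inv := hgf, right_inv := hfg }⟩, ?_⟩
    · exact fun x y => map_add e.hom.toLieModuleHom x y
    · exact fun a x => map_smul e.hom.toLieModuleHom a x
    · intro y v
      obtain ⟨x, rfl⟩ := hsurj y
      rw [← hV]
      exact LieModuleHom.map_lie e.hom.toLieModuleHom x v
    · obtain ⟨v, hv⟩ := exists_ne (0 : V.carrier)
      by_contra hne
      have h : e.hom.toLieModuleHom v ∈ if r = s then (⊤ : Submodule ℂ M) else ⊥ :=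
        e.hom.map_piece r v (hr ▸ Submodule.mem_top)
      rw [if_neg (Ne.symm hne)] at h
      have h0 : f v = 0 := h
      have := hgf v
      rw [h0] at this
      exact hv (this.symm.trans (map_zero e.inv.toLieModuleHom))
  · rintro ⟨⟨e⟩, rfl⟩
    have hbot : ∀ t, t ≠ s → ∀ v ∈ V.piece t, v = 0 := fun t ht v hv => by
      by_contra hv0
      exact ht (V.eq_of_mem_of_mem hv0 hv (hr ▸ Submodule.mem_top))
    refine ⟨⟨⟨{ toFun := e, map_add' := map_add e, map_smul' := map_smul e, map_lie' := ?_ }, ?_⟩,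
      ⟨{ toFun := e.symm, map_add' := map_add e.symm, map_smul' := map_smul e.symm,
         map_lie' := ?_ }, ?_⟩, ?_, ?_⟩⟩
    · intro x v
      change e ⁅x, v⁆ = ⁅π x, e v⁆
      rw [hV]
      exact LieModuleHom.map_lie (e : V.carrier →ₗ⁅ℂ, L⁆ M) _ _
    · intro t v hv
      change e v ∈ if t = s then (⊤ : Submodule ℂ M) else ⊥
      split_ifs with h
      · trivial
      · rw [hbot t h v hv, map_zero]; exact zero_mem _
    · intro x m
      change e.symm ⁅π x, (m : M)⁆ = ⁅x, e.symm m⁆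
      rw [hV]
      exact LieModuleHom.map_lie (e.symm : M →ₗ⁅ℂ, L⁆ V.carrier) _ _
    · intro t m hm
      change e.symm m ∈ V.piece t
      by_cases h : t = s
      · rw [h, hr]; trivial
      · change m ∈ (if t = s then (⊤ : Submodule ℂ M) else ⊥) at hm
        rw [if_neg h] at hm
        have hm0 : m = (0 : M) := hm
        rw [hm0, map_zero]; exact zero_mem _
    · exact GradedRep.Hom.ext (LieModuleHom.ext fun v => e.symm_apply_apply v)
    · exact GradedRep.Hom.ext (LieModuleHom.ext fun m => e.apply_symm_apply m)

/-- A simple object is a module `V(λ)` placed in a single degree, if the degree-zero part `L` of `𝔞`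
is semisimple and all other degrees are positive. -/
theorem existsUnique_iso_concentratedAt [Simple V] (h𝒜 : ⨆ i, 𝒜 i = ⊤) (d : Γ →+ ℤ)
    (hd : ∀ i, 0 ≤ d (c i)) (hd0 : ∀ i, d (c i) = 0 → c i = 0)
    {L : Type u} [LieRing L] [LieAlgebra ℂ L] [FiniteDimensional ℂ L]
    [LieAlgebra.IsSemisimple ℂ L] {H : LieSubalgebra ℂ L} [H.IsCartanSubalgebra]
    (b : (LieAlgebra.IsKilling.rootSystem H).Base) (π : 𝔞 →ₗ⁅ℂ⁆ L) (σ : L →ₗ⁅ℂ⁆ 𝔞)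
    (hπσ : ∀ y, π (σ y) = y) (hσπ : ∀ i, ∀ x ∈ 𝒜 i, c i = 0 → σ (π x) = x)
    (hπ : ∀ (i : I) (x : 𝔞), x ∈ 𝒜 i → c i ≠ 0 → π x = 0) :
    ∃! p : dominantWeights b × Γ,
      Nonempty (V.obj ≅ concentratedAt π hπ (HWModule b p.1) p.2) := by
  have := nontrivial_of_simple (V := V)
  obtain ⟨r, hr⟩ := exists_piece_eq_top (V := V) h𝒜 d hd hd0
  let : LieRingModule L V.obj.carrier := LieRingModule.compLieHom V.obj.carrier σ
  have : LieModule ℂ L V.obj.carrier := LieModule.compLieHom V.obj.carrier σ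
  have hV : ∀ (x : 𝔞) (v : V.obj.carrier), ⁅x, v⁆ = ⁅π x, v⁆ := by
    intro x v
    change ⁅x, v⁆ = ⁅σ (π x), v⁆
    have hx : x ∈ ⨆ i, 𝒜 i := h𝒜 ▸ Submodule.mem_top
    induction hx using Submodule.iSup_induction' with
    | zero => simp
    | add x y _ _ hx hy => rw [map_add, map_add, add_lie, add_lie, hx, hy]
    | mem i x hx =>
      by_cases hi : c i = 0
      · rw [hσπ i x hx hi]
      · rw [hπ i x hx hi, map_zero, zero_lie]
        -- A nonzero `⁅x, v⁆` would have both degree `r` and degree `c i + r`.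
        by_contra hne
        have hmem := V.obj.lie_mem i r x v hx (hr ▸ Submodule.mem_top)
        exact hi (add_eq_right.1 (V.obj.eq_of_mem_of_mem hne hmem (hr ▸ Submodule.mem_top)))
  have : FiniteDimensional ℂ V.obj.carrier := by
    have h : FiniteDimensional ℂ (V.obj.piece r) := V.property r
    exact Module.Finite.equiv (LinearEquiv.ofTop _ hr)
  have : LieModule.IsIrreducible ℂ L V.obj.carrier := by
    refine LieModule.IsIrreducible.mk fun N hN => ?_
    let N' : LieSubmodule ℂ 𝔞 V.obj.carrier :=
      { (N : Submodule ℂ V.obj.carrier) with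
        lie_mem := fun {x m} hm => by
          rw [hV]
          exact N.lie_mem (x := π x) hm }
    have hN' : N' = ⊥ ∨ N' = ⊤ := by
      -- With all of `V` in degree `r`, every submodule is graded, so simplicity in the category
      -- gives irreducibility.
      refine eq_bot_or_eq_top_of_simple N' (le_trans ?_ (le_iSup _ r))
      rw [hr, inf_top_eq]
    have hmem : ∀ v, v ∈ N' ↔ v ∈ N := fun v => Iff.rfl
    rcases hN' with h | h
    · refine absurd ((LieSubmodule.eq_bot_iff N).2 fun v hv => ?_) hN
      rw [← hmem, h] at hv
      simpa using hv
    · rw [eq_top_iff]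
      intro v _
      rw [← hmem, h]
      trivial
  have hiff := fun p : dominantWeights b × Γ =>
    nonempty_iso_concentratedAt_iff (hπ := hπ) (M := HWModule b p.1) (s := p.2) V.obj hV
      (fun y => ⟨σ y, hπσ y⟩) hr
  obtain ⟨wt, hwt, huniq⟩ := existsUnique_dominantWeight b (M := V.obj.carrier)
  refine ⟨(wt, r), (hiff _).2 ⟨hwt, rfl⟩, fun p hp => ?_⟩
  obtain ⟨h1, h2⟩ := (hiff p).1 hp
  exact Prod.ext (huniq _ h1) h2

end Graded

/-! ### The two gradings of `𝔞` and the final statement. -/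

section Multigraded

variable {l : ℕ} {𝔞 : Type u} [LieRing 𝔞] [LieAlgebra ℂ 𝔞]
  {𝒜 : (Fin l → ℕ) → Submodule ℂ 𝔞} [GradedLieAlgebra 𝒜]

theorem toDegreeZero_coe (y : degreeZero 𝒜) : toDegreeZero 𝒜 y = y :=
  Subtype.ext (DirectSum.decompose_of_mem_same 𝒜 y.2)

theorem coe_toDegreeZero_of_mem {x : 𝔞} (hx : x ∈ 𝒜 0) : (toDegreeZero 𝒜 x : 𝔞) = x :=
  DirectSum.decompose_of_mem_same 𝒜 hx

omit [GradedLieAlgebra 𝒜] in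
theorem totalGrading_zero_le : totalGrading 𝒜 0 ≤ 𝒜 0 := by
  refine iSup₂_le fun r hr => ?_
  have : r = 0 := funext fun j => by simpa using Finset.sum_eq_zero_iff.1 hr j
  rw [this]

variable (𝒜) in
theorem iSup_grading_eq_top : ⨆ r, 𝒜 r = ⊤ :=
  (DirectSum.Decomposition.isInternal 𝒜).submodule_iSup_eq_top

variable (𝒜) in
theorem iSup_totalGrading_eq_top : ⨆ n, totalGrading 𝒜 n = ⊤ := by
  rw [eq_top_iff, ← iSup_grading_eq_top 𝒜]
  refine iSup_le fun r => le_iSup_of_le (∑ j, r j) ?_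
  exact le_iSup₂ (f := fun s (_ : ∑ j, s j = ∑ j, r j) => 𝒜 s) r rfl

theorem inclusion_eq_zero_iff {r : Fin l → ℕ} : inclusion l r = 0 ↔ r = 0 := by
  simp [inclusion, funext_iff]

/-- The sum of the coordinates. -/
def totalDegree (l : ℕ) : (Fin l → ℤ) →+ ℤ where
  toFun s := ∑ j, s j
  map_zero' := by simp
  map_add' s t := by simp [Finset.sum_add_distrib]

theorem totalDegree_inclusion (r : Fin l → ℕ) :
    totalDegree l (inclusion l r) = ((∑ j, r j : ℕ) : ℤ) := by
  simp [totalDegree, inclusion]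

end Multigraded

end MultigradedLie

end

theorem theorem1p1 {l : ℕ} (hl : 0 < l) {𝔞 : Type u} [LieRing 𝔞] [LieAlgebra ℂ 𝔞]
    (𝒜 : (Fin l → ℕ) → Submodule ℂ 𝔞) [GradedLieAlgebra 𝒜]
    [∀ r, FiniteDimensional ℂ (𝒜 r)]
    [LieAlgebra.IsSemisimple ℂ (MultigradedLie.degreeZero 𝒜)]
    (H : LieSubalgebra ℂ (MultigradedLie.degreeZero 𝒜)) [H.IsCartanSubalgebra]
    (b : (LieAlgebra.IsKilling.rootSystem H).Base) :
    (∀ V : MultigradedLie.CatG 𝒜, Simple V →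
      ∃! p : MultigradedLie.dominantWeights b × (Fin l → ℤ),
        Nonempty (V.obj ≅ MultigradedLie.evG b p.1 p.2)) ∧
    (∀ V : MultigradedLie.CatD 𝒜, Simple V →
      ∃! p : MultigradedLie.dominantWeights b × ℤ,
        Nonempty (V.obj ≅ MultigradedLie.evD b p.1 p.2)) := by
  open MultigradedLie in
  refine ⟨fun V _ => ?_, fun V _ => ?_⟩
  -- The positive degree on `ℤ^ℓ` is the sum of the coordinates, which vanishes on `ℤ_{≥0}^ℓ` only
  -- at 0.
  · refine existsUnique_iso_concentratedAt (iSup_grading_eq_top 𝒜) (totalDegree l)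
      (fun r => ?_) (fun r hr => ?_) b (toDegreeZero 𝒜) (degreeZero 𝒜).incl toDegreeZero_coe
      (fun r x hx hr => ?_) _
    · rw [totalDegree_inclusion]
      exact Nat.cast_nonneg _
    · rw [totalDegree_inclusion, Nat.cast_eq_zero] at hr
      exact inclusion_eq_zero_iff.2 (funext fun j => by simpa using Finset.sum_eq_zero_iff.1 hr j)
    · rw [inclusion_eq_zero_iff] at hr
      exact coe_toDegreeZero_of_mem (hr ▸ hx)
  -- Here the degree is the identity of `ℤ`, and the piece of total degree 0 is contained in `𝒜 0`.
  · refine existsUnique_iso_concentratedAt (iSup_totalGrading_eq_top 𝒜) (AddMonoidHom.id ℤ)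
      (fun n => Nat.cast_nonneg n) (fun n hn => hn) b (toDegreeZero 𝒜) (degreeZero 𝒜).incl
      toDegreeZero_coe (fun n x hx hn => ?_) _
    have hn' : n = 0 := Nat.cast_eq_zero.1 hn
    exact coe_toDegreeZero_of_mem (totalGrading_zero_le (hn' ▸ hx))
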